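/- Let $m\ge 1$ be an integer and let $\beta>1$ be the real number satisfying $\beta^2=m\beta+1$. Put $I_\beta=\left[-\frac{\beta}{\beta+1},\frac{1}{\beta+1}\right)$, let $T_{-\beta}:I_\beta\to I_\beta$ be given by $T_{-\beta}(x)=-\beta x-\left\lfloor-\beta x+\frac{\beta}{\beta+1}\right\rfloor$, and for $x\in I_\beta$ let $d_{-\beta}(x)=x_1x_2x_3\cdots$ be the string of digits $x_i=\left\lfloor-\beta T_{-\beta}^{i-1}(x)+\frac{\beta}{\beta+1}\right\rfloor$. A string is called admissible if it equals $d_{-\beta}(x)$ for some $x\in I_\beta$. The $(-\beta)$-expansion of a real number $x\neq0$ is its unique representation $x=\sum_{i=1}^{\infty}x_i(-\beta)^{n-i+1}$ with $n\in\mathbb Z$, $x_1\neq0$ and $0x_1x_2x_3\cdots$ admissible; it is finite if $x_i=0$ for all sufficiently large $i$. Let $\mathrm{Fin}(-\beta)$ be the set consisting of $0$ and of all real numbers $x\ne 0$ whose $(-\beta)$-expansion is finite. Then the field $\mathbb Q(\beta)$ has exactly one automorphism $z\mapsto z'$ different from the identity, and $$\mathrm{Fin}(-\beta)=\{z\in\mathbb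 Z[\beta] \mid z'\ge 0\}.$$ -/

import Mathlib

open IntermediateField

noncomputable section

namespace NegBeta

/-- The interval `I_β = [-β/(β+1), 1/(β+1))`. -/
def interval (β : ℝ) : Set ℝ := Set.Ico (-(β / (β + 1))) (1 / (β + 1))

/-- The transformation `T(x) = -βx - ⌊-βx + β/(β+1)⌋`, used only on `I_β`, which it maps to
itself. -/
def transform (β x : ℝ) : ℝ := -β * x - (⌊-β * x + β / (β + 1)⌋ : ℤ)

/-- The digit string `d(x)`, indexed from `0`: its `i`-th letter is `⌊-β T^i(x) + β/(β+1)⌋`. -/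
def digits (β x : ℝ) (i : ℕ) : ℤ := ⌊-β * ((transform β)^[i] x) + β / (β + 1)⌋

/-- A string is admissible if it is `d(x)` for some `x ∈ I_β`. -/
def Admissible (β : ℝ) (y : ℕ → ℤ) : Prop := ∃ x ∈ interval β, digits β x = y

/-- The string `0 y₀ y₁ y₂ ⋯`. -/
def consZero (y : ℕ → ℤ) : ℕ → ℤ
  | 0 => 0
  | i + 1 => y i

/-- `x = ∑_{i ≥ 0} y_i (-β)^(n - i)` is the `(-β)`-expansion of `x`: the leading digit `y₀` is
nonzero and `0 y₀ y₁ ⋯` is admissible. Only nonzero `x` have such an expansion. -/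
structure IsExpansion (β x : ℝ) (n : ℤ) (y : ℕ → ℤ) : Prop where
  leading_ne_zero : y 0 ≠ 0
  admissible : Admissible β (consZero y)
  hasSum : HasSum (fun i : ℕ => (y i : ℝ) * (-β) ^ (n - (i : ℤ))) x

/-- The set of real numbers with finite `(-β)`-expansion, i.e. one whose string ends in repeating
zeros. The number `0`, represented by the string of zeros, belongs to it. -/
def finiteExpansions (β : ℝ) : Set ℝ :=
  {x | x = 0 ∨ ∃ (n : ℤ) (y : ℕ → ℤ), IsExpansion β x n y ∧ ∃ N : ℕ, ∀ i ≥ N, y i = 0}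

end NegBeta

end

namespace NegBeta

/-! Conjugation sends `β` to `m - β = -β⁻¹`, hence `-β` to the positive number `β⁻¹`. Digits are
nonnegative, so a finite expansion conjugates to a sum of nonnegative terms.

Conversely, scale a nonzero point of `ℤ[β]` with nonnegative conjugate into the interval
(`exists_scaling`). Along its orbit the conjugate evolves by `z ↦ β⁻¹ * z - d` with `0 ≤ d ≤ m`: it
stays above `-(β + 1)` and is eventually below `1` (`iterate_isConj`). Within these bounds `0` is
the only point of `ℤ[β]` in the interval (`eq_zero_of_isConj`), so the orbit reaches `0` and the
digits stop.

The argument uses a relation between reals; `exists_isConj_iff` translates it to the automorphism.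
-/

/-- `x` and `y` are conjugate elements `a + bβ` and `a + b(m - β)` of `ℤ[β]`, where
`β ^ 2 = m * β + 1`. -/
def IsConj (m : ℕ) (β x y : ℝ) : Prop :=
  ∃ a b : ℤ, x = a + b * β ∧ y = a + b * (m - β)

/-! ### Conjugation on `ℤ[β]` -/

section Conj

variable {m : ℕ} {β x y x₁ y₁ : ℝ}

theorem IsConj.zero : IsConj m β 0 0 := ⟨0, 0, by simp, by simp⟩

theorem IsConj.intCast (a : ℤ) : IsConj m β a a := ⟨a, 0, by simp, by simp⟩

theorem IsConj.add (h : IsConj m β x y) (h₁ : IsConj m β x₁ y₁) :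
    IsConj m β (x + x₁) (y + y₁) := by
  obtain ⟨a, b, rfl, rfl⟩ := h
  obtain ⟨c, d, rfl, rfl⟩ := h₁
  exact ⟨a + c, b + d, by push_cast; ring, by push_cast; ring⟩

theorem IsConj.sub_intCast (h : IsConj m β x y) (d : ℤ) : IsConj m β (x - d) (y - d) := by
  simpa [sub_eq_add_neg] using h.add (IsConj.intCast (-d))

theorem natCast_sub_root (hβ : 0 < β) (hroot : β ^ 2 = m * β + 1) : (m : ℝ) - β = -β⁻¹ := by
  field_simp
  linarith

theorem IsConj.neg_mul (hβ : 0 < β) (hroot : β ^ 2 = m * β + 1) (h : IsConj m β x y) :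
    IsConj m β (-β * x) (β⁻¹ * y) := by
  have hinv : β⁻¹ = β - m := by linarith [natCast_sub_root hβ hroot]
  obtain ⟨a, b, rfl, rfl⟩ := h
  refine ⟨-b, -a - m * b, ?_, ?_⟩
  · push_cast
    linear_combination (-b : ℝ) * hroot
  · rw [hinv]
    push_cast
    linear_combination (-b : ℝ) * hroot

theorem IsConj.inv_mul (hβ : 0 < β) (hroot : β ^ 2 = m * β + 1) (h : IsConj m β x y) :
    IsConj m β ((-β)⁻¹ * x) (β * y) := by
  have hinv : (-β)⁻¹ = m - β := by rw [inv_neg, natCast_sub_root hβ hroot]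
  obtain ⟨a, b, rfl, rfl⟩ := h
  refine ⟨m * a - b, -a, ?_, ?_⟩
  · rw [hinv]
    push_cast
    linear_combination (-b : ℝ) * hroot
  · push_cast
    linear_combination (-b : ℝ) * hroot

/-- `-β` is a unit of `ℤ[β]` with conjugate `β⁻¹`, so scaling by any power of it, even a negative
one, stays in `ℤ[β]` and keeps the sign of the conjugate. -/
theorem IsConj.zpow_mul (hβ : 0 < β) (hroot : β ^ 2 = m * β + 1) (h : IsConj m β x y) (k : ℤ) :
    IsConj m β ((-β) ^ k * x) (β ^ (-k) * y) := by
  have h0 : β ≠ 0 := hβ.ne'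
  induction k with
  | zero => simpa using h
  | succ k ih =>
    convert ih.neg_mul hβ hroot using 1
    · rw [zpow_add_one₀ (neg_ne_zero.2 h0)]; ring
    · rw [neg_add, ← sub_eq_add_neg, zpow_sub_one₀ h0]; ring
  | pred k ih =>
    convert ih.inv_mul hβ hroot using 1
    · rw [zpow_sub_one₀ (neg_ne_zero.2 h0)]; ring
    · rw [neg_sub, sub_neg_eq_add, add_comm, zpow_add_one₀ h0, neg_neg]; ring

theorem IsConj.sum {ι : Type*} (s : Finset ι) {f g : ι → ℝ} (h : ∀ i ∈ s, IsConj m β (f i) (g i)) :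
    IsConj m β (∑ i ∈ s, f i) (∑ i ∈ s, g i) := by
  classical
  induction s using Finset.induction_on with
  | empty => simpa using IsConj.zero
  | insert i s hi ih =>
    rw [Finset.sum_insert hi, Finset.sum_insert hi]
    exact (h i (by simp)).add (ih fun j hj => h j (by simp [hj]))

end Conj

/-! ### Orbits of the transformation and finite expansions -/

section Dynamics

variable {β x : ℝ}

theorem one_sub_div_add_one (hβ : 0 < β) : 1 - β / (β + 1) = 1 / (β + 1) := by
  field_simp
  ring

theorem transform_mem (hβ : 0 < β) (x : ℝ) : transform β x ∈ interval β := by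
  have h1 := Int.floor_le (-β * x + β / (β + 1))
  have h2 := Int.lt_floor_add_one (-β * x + β / (β + 1))
  have h3 := one_sub_div_add_one hβ
  constructor <;> unfold transform <;> linarith

theorem iterate_transform_mem (hβ : 0 < β) (hx : x ∈ interval β) (i : ℕ) :
    (transform β)^[i] x ∈ interval β := by
  cases i with
  | zero => simpa using hx
  | succ i =>
    rw [Function.iterate_succ_apply']
    exact transform_mem hβ _

theorem floor_eq_zero_iff (hβ : 0 < β) : ⌊x + β / (β + 1)⌋ = 0 ↔ x ∈ interval β := by
  have h3 := one_sub_div_add_one hβ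
  rw [Int.floor_eq_zero_iff, interval, Set.mem_Ico, Set.mem_Ico]
  constructor <;> rintro ⟨h1, h2⟩ <;> constructor <;> linarith

theorem zero_mem_interval (hβ : 0 < β) : (0 : ℝ) ∈ interval β := by
  constructor
  · have : 0 ≤ β / (β + 1) := by positivity
    linarith
  · positivity

theorem transform_eq_of_mem (hβ : 0 < β) (hx : -β * x ∈ interval β) : transform β x = -β * x := by
  rw [transform, (floor_eq_zero_iff hβ).2 hx]
  simp

theorem transform_zero (hβ : 0 < β) : transform β 0 = 0 := by
  rw [transform_eq_of_mem hβ (by simpa using zero_mem_interval hβ), mul_zero]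

theorem iterate_transform_succ (i : ℕ) :
    (transform β)^[i + 1] x = -β * (transform β)^[i] x - digits β x i := by
  rw [Function.iterate_succ_apply']
  rfl

/-- The offset `β / (β + 1)` is `β` times the right endpoint, so the floored quantity is positive on
the interval. -/
theorem digits_nonneg (hβ : 0 < β) (hx : x ∈ interval β) (i : ℕ) : 0 ≤ digits β x i := by
  have h := (iterate_transform_mem hβ hx i).2
  rw [digits, Int.floor_nonneg]
  have h2 : β * (transform β)^[i] x ≤ β * (1 / (β + 1)) := by gcongr
  have h3 : β * (1 / (β + 1)) = β / (β + 1) := by ring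
  linarith

/-- The floored quantity is largest at the left endpoint, where it equals `β = m + β⁻¹ < m + 1`. -/
theorem digits_le {m : ℕ} (hβ : 1 < β) (hroot : β ^ 2 = m * β + 1) (hx : x ∈ interval β) (i : ℕ) :
    digits β x i ≤ m := by
  have h0 : 0 < β := by linarith
  have h := (iterate_transform_mem h0 hx i).1
  have h2 : β * -(β / (β + 1)) ≤ β * (transform β)^[i] x := by gcongr
  have h3 : β * (β / (β + 1)) + β / (β + 1) = β := by field_simp
  have h4 : β⁻¹ < 1 := inv_lt_one_of_one_lt₀ hβ
  have h5 := natCast_sub_root h0 hroot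
  rw [← Int.lt_add_one_iff, digits, Int.floor_lt]
  push_cast
  linarith

theorem digits_eq_zero (hβ : 0 < β) {N i : ℕ} (hN : (transform β)^[N] x = 0) (hi : N ≤ i) :
    digits β x i = 0 := by
  obtain ⟨k, rfl⟩ := Nat.exists_eq_add_of_le' hi
  rw [digits, Function.iterate_add_apply, hN, Function.iterate_fixed (transform_zero hβ),
    floor_eq_zero_iff hβ, mul_zero]
  exact zero_mem_interval hβ

/-- Expanding `N` digits of `x` leaves the remainder `T^N(x)`. -/
theorem eq_sum_digits_add (hβ : 0 < β) (x : ℝ) (N : ℕ) :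
    x = ∑ i ∈ Finset.range N, (digits β x i : ℝ) * (-β) ^ (-(i : ℤ) - 1) +
      (-β) ^ (-(N : ℤ)) * (transform β)^[N] x := by
  have h0 : -β ≠ 0 := neg_ne_zero.2 hβ.ne'
  induction N with
  | zero => simp
  | succ N ih =>
    rw [Finset.sum_range_succ, iterate_transform_succ]
    have : (-β) ^ (-((N + 1 : ℕ) : ℤ)) = (-β) ^ (-(N : ℤ) - 1) := by
      congr 1
      push_cast
      ring
    have h2 : (-β) ^ (-(N : ℤ)) = (-β) ^ (-(N : ℤ) - 1) * (-β) := by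
      rw [← zpow_add_one₀ h0, sub_add_cancel]
    rw [this]
    rw [h2] at ih
    linear_combination ih

/-- The lower bound `-(β + 1)` is the fixed point of `z ↦ β⁻¹ * z - m`, the case of the largest
digit; the upper bound comes from dropping the digits. -/
theorem iterate_isConj {m : ℕ} (hβ : 1 < β) (hroot : β ^ 2 = m * β + 1) (hx : x ∈ interval β)
    {y : ℝ} (h : IsConj m β x y) (hy : 0 ≤ y) (i : ℕ) :
    ∃ z, IsConj m β ((transform β)^[i] x) z ∧ -(β + 1) < z ∧ z ≤ y * β⁻¹ ^ i := by
  have h0 : 0 < β := by linarith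
  induction i with
  | zero => exact ⟨y, by simpa using h, by linarith, by simp⟩
  | succ i ih =>
    obtain ⟨z, hz, hlt, hle⟩ := ih
    have hd0 : (0 : ℝ) ≤ digits β x i := by exact_mod_cast digits_nonneg h0 hx i
    have hdm : (digits β x i : ℝ) ≤ m := by exact_mod_cast digits_le hβ hroot hx i
    have hinv := natCast_sub_root h0 hroot
    have hpos : 0 < β⁻¹ := inv_pos.2 h0
    refine ⟨β⁻¹ * z - digits β x i, ?_, ?_, ?_⟩
    · rw [iterate_transform_succ]
      exact (hz.neg_mul h0 hroot).sub_intCast _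
    · have h1 : β⁻¹ * -(β + 1) < β⁻¹ * z := by gcongr
      have h2 : β⁻¹ * -(β + 1) = -1 - β⁻¹ := by field_simp; ring
      linarith
    · have h1 : β⁻¹ * z ≤ β⁻¹ * (y * β⁻¹ ^ i) := by gcongr
      rw [pow_succ]
      linarith

/-- The interval is half-open of length `1`. -/
theorem int_eq_of_add_mem_interval (hβ : 0 < β) {a b : ℤ} {t : ℝ} (ha : a + t ∈ interval β)
    (hb : b + t ∈ interval β) : a = b := by
  have h := one_sub_div_add_one hβ
  have h1 : (a : ℝ) < b + 1 := by linarith [ha.2, hb.1]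
  have h2 : (b : ℝ) < a + 1 := by linarith [ha.1, hb.2]
  norm_cast at h1 h2
  lia

/-- The only other point of `ℤ[β]` in the interval with almost nonpositive, not too small conjugate
would be `β - m - 1`, whose conjugate is `-(β + 1)`. -/
theorem eq_zero_of_isConj {m : ℕ} (hβ : 1 < β) (hroot : β ^ 2 = m * β + 1) (hx : x ∈ interval β)
    {y : ℝ} (h : IsConj m β x y) (hlt : -(β + 1) < y) (hy : y < 1) : x = 0 := by
  have h0 : 0 < β := by linarith
  have hinv := natCast_sub_root h0 hroot
  have hpos : 0 < β⁻¹ := inv_pos.2 h0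
  have hmul : β * β⁻¹ = 1 := mul_inv_cancel₀ h0.ne'
  -- This is `(β - 1) ^ 2 / β > 0`.
  have hsum : 2 < β + β⁻¹ := by nlinarith [mul_pos hpos (pow_pos (sub_pos.2 hβ) 2)]
  have hsum2 : 2 < β + 2 * β⁻¹ := by linarith
  have hI := one_sub_div_add_one h0
  have hlow : β / (β + 1) < 1 := by rw [div_lt_one (by linarith)]; linarith
  have hup : 1 / (β + 1) < 1 := by rw [div_lt_one (by linarith)]; linarith
  obtain ⟨a, b, hxab, hyab⟩ := h
  -- The bounds on `x` and `y` give `-2 < x - y < β + 2`, which leaves only `b = 0` and `b = 1`.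
  have hdiff : x - y = b * (β + β⁻¹) := by rw [hxab, hyab, hinv]; ring
  have hb0 : (-1 : ℝ) < b := by
    by_contra! hb
    nlinarith [hx.1, hx.2]
  have hb2 : (b : ℝ) < 2 := by
    by_contra! hb
    nlinarith [hx.1, hx.2]
  have hb : b = 0 ∨ b = 1 := by
    norm_cast at hb0 hb2
    lia
  rcases hb with rfl | rfl
  · have : a = 0 := int_eq_of_add_mem_interval h0 (t := 0) (by simpa [hxab] using hx)
      (by simpa using zero_mem_interval h0)
    simp [hxab, this]
  · exfalso
    have hmem : ((-(m : ℤ) - 1 : ℤ) : ℝ) + β ∈ interval β := by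
      have e : ((-(m : ℤ) - 1 : ℤ) : ℝ) + β = β⁻¹ - 1 := by
        push_cast
        linarith
      have h1 : 1 / (β + 1) ≤ β⁻¹ := by
        rw [one_div]
        exact inv_anti₀ h0 (by linarith)
      have h2 : β⁻¹ < 1 := inv_lt_one_of_one_lt₀ hβ
      rw [e]
      constructor
      · linarith
      · have : 0 < 1 / (β + 1) := by positivity
        linarith
    have ha : a = -(m : ℤ) - 1 :=
      int_eq_of_add_mem_interval h0 (t := β) (by simpa [hxab] using hx) hmem
    rw [ha] at hyab
    push_cast at hyab
    linarith

theorem exists_iterate_eq_zero {m : ℕ} (hβ : 1 < β) (hroot : β ^ 2 = m * β + 1)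
    (hx : x ∈ interval β) {y : ℝ} (h : IsConj m β x y) (hy : 0 ≤ y) :
    ∃ N, (transform β)^[N] x = 0 := by
  have h0 : 0 < β := by linarith
  have hlim : Filter.Tendsto (fun i : ℕ => y * β⁻¹ ^ i) Filter.atTop (nhds (y * 0)) :=
    (tendsto_pow_atTop_nhds_zero_of_lt_one (inv_pos.2 h0).le
      (inv_lt_one_of_one_lt₀ hβ)).const_mul y
  obtain ⟨N, hN⟩ := (hlim.eventually_lt_const (u := 1) (by simp)).exists
  obtain ⟨z, hz, hlt, hle⟩ := iterate_isConj hβ hroot hx h hy N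
  exact ⟨N, eq_zero_of_isConj hβ hroot (iterate_transform_mem h0 hx N) hz hlt (hle.trans_lt hN)⟩

theorem interval_mem_nhds (hβ : 0 < β) : interval β ∈ nhds (0 : ℝ) := by
  refine Ico_mem_nhds ?_ (by positivity)
  have : 0 < β / (β + 1) := by positivity
  linarith

/-- Every nonzero `x` can be scaled by a power of `-β` into the interval so that its digit string
starts with `0` followed by a nonzero digit. -/
theorem exists_scaling (hβ : 1 < β) (hx : x ≠ 0) :
    ∃ n : ℤ, (-β) ^ (-n - 2) * x ∈ interval β ∧ (-β) ^ (-n - 1) * x ∈ interval β ∧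
      (-β) ^ (-n) * x ∉ interval β := by
  have h0 : 0 < β := by linarith
  -- All `j ≥ k` are required because membership can be lost on scaling down: dividing the left
  -- endpoint by `-β` gives the excluded right endpoint.
  let P : ℤ → Prop := fun k => ∀ j ≥ k, (-β) ^ (-j) * x ∈ interval β
  have hbdd : ∃ b : ℤ, ∀ k, P k → b ≤ k := by
    obtain ⟨M, hM⟩ := pow_unbounded_of_one_lt |x|⁻¹ hβ
    refine ⟨-M, fun k hk => ?_⟩
    by_contra! hlt
    have hmem := hk (-M) hlt.le
    have h1 : 1 / (β + 1) < 1 := by rw [div_lt_one (by linarith)]; linarith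
    have h2 : β / (β + 1) < 1 := by rw [div_lt_one (by linarith)]; linarith
    have habs : |(-β) ^ (-(-(M : ℤ))) * x| < 1 := by
      rw [abs_lt]
      exact ⟨by linarith [hmem.1], by linarith [hmem.2]⟩
    rw [neg_neg, zpow_natCast, abs_mul, abs_pow, abs_neg, abs_of_pos h0] at habs
    have hxpos := abs_pos.2 hx
    have h3 : |x|⁻¹ * |x| < β ^ M * |x| := by gcongr
    rw [inv_mul_cancel₀ hxpos.ne'] at h3
    linarith
  have hne : ∃ k, P k := by
    have hlim : Filter.Tendsto (fun i : ℕ => (-β)⁻¹ ^ i * x) Filter.atTop (nhds (0 * x)) := by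
      refine (tendsto_pow_atTop_nhds_zero_of_abs_lt_one ?_).mul_const x
      rw [abs_inv, abs_neg, abs_of_pos h0]
      exact inv_lt_one_of_one_lt₀ hβ
    rw [zero_mul] at hlim
    obtain ⟨K, hK⟩ := Filter.eventually_atTop.1 (hlim.eventually_mem (interval_mem_nhds h0))
    refine ⟨K, fun j hj => ?_⟩
    lift j to ℕ using by lia
    rw [zpow_neg, zpow_natCast, ← inv_pow]
    exact hK j (by exact_mod_cast hj)
  obtain ⟨k, hk, hmin⟩ := Int.exists_least_of_bdd hbdd hne
  refine ⟨k - 1, ?_, ?_, fun hmem => ?_⟩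
  · convert hk (k + 1) (by lia) using 3
    ring
  · convert hk k le_rfl using 3
    ring
  · have : P (k - 1) := fun j hj => by
      rcases eq_or_lt_of_le hj with rfl | hj
      · exact hmem
      · exact hk j (by lia)
    have := hmin _ this
    lia

theorem mem_finiteExpansions_of_isConj {m : ℕ} (hβ : 1 < β) (hroot : β ^ 2 = m * β + 1) {y : ℝ}
    (h : IsConj m β x y) (hy : 0 ≤ y) : x ∈ finiteExpansions β := by
  have h0 : 0 < β := by linarith
  have hne : -β ≠ 0 := neg_ne_zero.2 h0.ne'
  rcases eq_or_ne x 0 with rfl | hx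
  · exact Or.inl rfl
  obtain ⟨n, h2, h1, hn⟩ := exists_scaling hβ hx
  set w := (-β) ^ (-n - 2) * x with hw
  have e1 : -β * w = (-β) ^ (-n - 1) * x := by
    rw [hw, ← mul_assoc, mul_comm (-β), ← zpow_add_one₀ hne]
    congr 2
    ring
  have e2 : -β * (-β * w) = (-β) ^ (-n) * x := by
    rw [e1, ← mul_assoc, mul_comm (-β), ← zpow_add_one₀ hne]
    congr 2
    ring
  have hT : transform β w = -β * w := transform_eq_of_mem h0 (e1 ▸ h1)
  have hd0 : digits β w 0 = 0 := (floor_eq_zero_iff h0).2 (e1 ▸ h1)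
  obtain ⟨N, hN⟩ := exists_iterate_eq_zero hβ hroot h2 (h.zpow_mul h0 hroot (-n - 2))
    (mul_nonneg (zpow_nonneg h0.le _) hy)
  have htail : ∀ i ≥ N, digits β w (i + 1) = 0 := fun i hi => digits_eq_zero h0 hN (by lia)
  -- Digit `0` of `w` is the prepended zero, hence the shift by one.
  refine Or.inr ⟨n, fun i => digits β w (i + 1), ⟨?_, ⟨w, h2, ?_⟩, ?_⟩, N, htail⟩
  · intro hzero
    apply hn
    rw [← e2, ← floor_eq_zero_iff h0, ← hT]
    simpa [digits] using hzero
  · funext i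
    cases i with
    | zero => exact hd0
    | succ i => rfl
  · have hsum := hasSum_sum_of_ne_finset_zero (s := Finset.range N)
      (f := fun i : ℕ => (digits β w (i + 1) : ℝ) * (-β) ^ (n - (i : ℤ)))
      (L := SummationFilter.unconditional ℕ)
      (fun i hi => by simp [htail i (by simpa using hi)])
    convert hsum using 1
    -- `N + 1` digits of `w` are `N` digits of the expansion after the leading zero; the remainder
    -- vanishes.
    have hexp := eq_sum_digits_add h0 w (N + 1)
    rw [iterate_transform_succ, hN, digits_eq_zero h0 hN le_rfl, Finset.sum_range_succ', hd0] at hexp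
    have hxw : x = (-β) ^ (n + 2) * w := by
      rw [hw, ← mul_assoc, ← zpow_add₀ hne]
      simp
    rw [hxw]
    nth_rw 1 [hexp]
    simp only [Int.cast_zero, zero_mul, mul_zero, sub_zero, add_zero, Finset.mul_sum]
    refine Finset.sum_congr rfl fun i _ => ?_
    rw [mul_left_comm, ← zpow_add₀ hne]
    congr 2
    push_cast
    ring

theorem exists_isConj_of_mem_finiteExpansions {m : ℕ} (hβ : 1 < β) (hroot : β ^ 2 = m * β + 1)
    (hx : x ∈ finiteExpansions β) : ∃ y, IsConj m β x y ∧ 0 ≤ y := by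
  have h0 : 0 < β := by linarith
  rcases hx with rfl | ⟨n, d, ⟨-, ⟨w, hw, hd⟩, hsum⟩, N, hN⟩
  · exact ⟨0, IsConj.zero, le_rfl⟩
  have hnonneg : ∀ i, (0 : ℝ) ≤ d i := fun i => by
    have h := digits_nonneg h0 hw (i + 1)
    rw [hd] at h
    exact_mod_cast h
  have hfin := hsum.unique (hasSum_sum_of_ne_finset_zero (s := Finset.range N)
    (fun i hi => by simp [hN i (by simpa using hi)]))
  refine ⟨∑ i ∈ Finset.range N, β ^ (-(n - (i : ℤ))) * d i, ?_, ?_⟩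
  · rw [hfin]
    refine IsConj.sum _ fun i _ => ?_
    rw [mul_comm]
    exact (IsConj.intCast (d i)).zpow_mul h0 hroot _
  · exact Finset.sum_nonneg fun i _ => mul_nonneg (zpow_nonneg h0.le _) (hnonneg i)

end Dynamics

/-! ### The field `ℚ(β)` and its automorphisms -/

section Field

open Polynomial

variable {m : ℕ} {β : ℝ}

/-- A rational root would be an integer `k` with `k * (k - m) = 1`, so `k = ±1`, against `k > 1`. -/
theorem ratCast_ne_root (hβ : 1 < β) (hroot : β ^ 2 = m * β + 1) (q : ℚ) : (q : ℝ) ≠ β := by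
  rintro rfl
  have hq : q ^ 2 = m * q + 1 := by exact_mod_cast hroot
  have hint : IsIntegral ℤ q := by
    refine ⟨X ^ 2 - C (m : ℤ) * X - 1, by monicity!, ?_⟩
    simp [hq]
  obtain ⟨k, rfl⟩ := IsIntegrallyClosed.isIntegral_iff.1 hint
  have hk : k * (k - m) = 1 := by
    have : (k : ℚ) ^ 2 = m * k + 1 := by simpa using hq
    have : k ^ 2 = m * k + 1 := by exact_mod_cast this
    linear_combination this
  have hk1 : 1 < k := by
    have : (1 : ℝ) < k := by simpa using hβ
    exact_mod_cast this
  rcases Int.eq_one_or_neg_one_of_mul_eq_one hk with h | h <;> lia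

theorem minpoly_root (hβ : 1 < β) (hroot : β ^ 2 = m * β + 1) :
    minpoly ℚ β = X ^ 2 - C (m : ℚ) * X - 1 := by
  have hmonic : (X ^ 2 - C (m : ℚ) * X - 1 : ℚ[X]).Monic := by monicity!
  have hdeg : (X ^ 2 - C (m : ℚ) * X - 1 : ℚ[X]).natDegree = 2 := by compute_degree!
  refine (minpoly.eq_of_irreducible_of_monic ?_ ?_ hmonic).symm
  · rw [hmonic.irreducible_iff_roots_eq_zero_of_degree_le_three hdeg.ge (by lia),
      Multiset.eq_zero_iff_forall_notMem]
    intro q hq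
    have hq : q ^ 2 - m * q - 1 = 0 := by simpa using (mem_roots'.1 hq).2
    have hq' : (q : ℝ) ^ 2 - m * q - 1 = 0 := by exact_mod_cast hq
    -- With `q`, the other root `m - q` is rational too, and one of the two is `β`.
    have hfac : ((q : ℝ) - β) * (((m - q : ℚ) : ℝ) - β) = 0 := by
      push_cast
      linear_combination hroot - hq'
    rcases mul_eq_zero.1 hfac with h | h
    · exact ratCast_ne_root hβ hroot _ (sub_eq_zero.1 h)
    · exact ratCast_ne_root hβ hroot _ (sub_eq_zero.1 h)
  · simp [hroot]

theorem gen_sq (hroot : β ^ 2 = m * β + 1) :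
    AdjoinSimple.gen ℚ β ^ 2 = m * AdjoinSimple.gen ℚ β + 1 := by
  apply Subtype.ext
  simpa using hroot

theorem isIntegral_root (hroot : β ^ 2 = m * β + 1) : IsIntegral ℚ β :=
  ⟨X ^ 2 - C (m : ℚ) * X - 1, by monicity!, by simp [hroot]⟩

/-- `σ` permutes the roots of `X ^ 2 - m * X - 1`, and it is the identity if it fixes the generator.
-/
theorem algEquiv_gen (hroot : β ^ 2 = m * β + 1) {σ : ℚ⟮β⟯ ≃ₐ[ℚ] ℚ⟮β⟯} (hσ : σ ≠ AlgEquiv.refl) :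
    σ (AdjoinSimple.gen ℚ β) = m - AdjoinSimple.gen ℚ β := by
  have hg := gen_sq hroot
  have hσg : σ (AdjoinSimple.gen ℚ β) ^ 2 = m * σ (AdjoinSimple.gen ℚ β) + 1 := by
    simpa using congrArg σ hg
  have hfac : (σ (AdjoinSimple.gen ℚ β) - AdjoinSimple.gen ℚ β) *
      (σ (AdjoinSimple.gen ℚ β) - (m - AdjoinSimple.gen ℚ β)) = 0 := by
    linear_combination hσg - hg
  rcases mul_eq_zero.1 hfac with h | h
  · refine absurd (AlgEquiv.coe_toAlgHom_injective ?_) hσ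
    exact IntermediateField.algHom_ext_of_eq_adjoin _ rfl (by
      rintro x (rfl : x = β)
      exact sub_eq_zero.1 h)
  · exact sub_eq_zero.1 h

theorem existsUnique_algEquiv_ne_refl (hβ : 1 < β) (hroot : β ^ 2 = m * β + 1) :
    ∃! σ : ℚ⟮β⟯ ≃ₐ[ℚ] ℚ⟮β⟯, σ ≠ AlgEquiv.refl := by
  have hint := isIntegral_root hroot
  have hfd : FiniteDimensional ℚ ℚ⟮β⟯ := adjoin.finiteDimensional hint
  have hg := gen_sq hroot
  let pb := adjoin.powerBasis hint
  have hgen : pb.gen = AdjoinSimple.gen ℚ β := adjoin.powerBasis_gen hint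
  have hlift : aeval ((m : ℚ⟮β⟯) - AdjoinSimple.gen ℚ β) (minpoly ℚ pb.gen) = 0 := by
    have hmin : minpoly ℚ pb.gen = X ^ 2 - C (m : ℚ) * X - 1 := by
      rw [hgen]
      exact (minpoly_gen ℚ β).trans (minpoly_root hβ hroot)
    rw [hmin]
    simp
    linear_combination hg
  let φ : ℚ⟮β⟯ →ₐ[ℚ] ℚ⟮β⟯ := pb.lift _ hlift
  have hφ : φ (AdjoinSimple.gen ℚ β) = m - AdjoinSimple.gen ℚ β := by
    have h := pb.lift_gen _ hlift
    rwa [hgen] at h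
  refine ⟨AlgEquiv.ofBijective φ φ.bijective, fun h => ?_, fun τ hτ => ?_⟩
  · have h1 : (m : ℚ⟮β⟯) - AdjoinSimple.gen ℚ β = AdjoinSimple.gen ℚ β := by
      rw [← hφ]
      exact DFunLike.congr_fun h _
    have h2 : (m : ℝ) - β = β := by simpa using congrArg Subtype.val h1
    refine ratCast_ne_root hβ hroot (m / 2) ?_
    push_cast
    linarith
  · refine AlgEquiv.coe_toAlgHom_injective (IntermediateField.algHom_ext_of_eq_adjoin _ rfl ?_)
    rintro x (rfl : x = β)
    exact (algEquiv_gen hroot hτ).trans hφ.symm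

theorem mem_adjoin_int_iff (hroot : β ^ 2 = m * β + 1) {x : ℝ} :
    x ∈ Algebra.adjoin ℤ {β} ↔ ∃ a b : ℤ, x = a + b * β := by
  constructor
  · intro hx
    induction hx using Algebra.adjoin_induction with
    | mem x hx => exact ⟨0, 1, by simpa using hx⟩
    | algebraMap r => exact ⟨r, 0, by simp⟩
    | add x y _ _ hx hy =>
      obtain ⟨a, b, rfl⟩ := hx
      obtain ⟨c, d, rfl⟩ := hy
      exact ⟨a + c, b + d, by push_cast; ring⟩
    | mul x y _ _ hx hy =>
      obtain ⟨a, b, rfl⟩ := hx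
      obtain ⟨c, d, rfl⟩ := hy
      refine ⟨a * c + b * d, a * d + b * c + m * (b * d), ?_⟩
      push_cast
      linear_combination (b * d : ℝ) * hroot
  · rintro ⟨a, b, rfl⟩
    have hβ : β ∈ Algebra.adjoin ℤ {β} := Algebra.self_mem_adjoin_singleton ℤ β
    exact add_mem (intCast_mem _ a) (mul_mem (intCast_mem _ b) hβ)

/-- The conjugation defined on `ℤ[β]` agrees with the nontrivial automorphism of `ℚ(β)`. -/
theorem exists_isConj_iff (hroot : β ^ 2 = m * β + 1) {σ : ℚ⟮β⟯ ≃ₐ[ℚ] ℚ⟮β⟯}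
    (hσ : σ ≠ AlgEquiv.refl) {x : ℝ} :
    (∃ y, IsConj m β x y ∧ 0 ≤ y) ↔
      ∃ z : ℚ⟮β⟯, (z : ℝ) = x ∧ x ∈ Algebra.adjoin ℤ {β} ∧ 0 ≤ ((σ z : ℚ⟮β⟯) : ℝ) := by
  have key (a b : ℤ) : ((σ (a + b * AdjoinSimple.gen ℚ β) : ℚ⟮β⟯) : ℝ) = a + b * (m - β) := by
    rw [map_add, map_mul, map_intCast, map_intCast, algEquiv_gen hroot hσ]
    simp
  constructor
  · rintro ⟨_, ⟨a, b, rfl, rfl⟩, hy⟩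
    refine ⟨a + b * AdjoinSimple.gen ℚ β, by simp, (mem_adjoin_int_iff hroot).2 ⟨a, b, rfl⟩, ?_⟩
    rwa [key]
  · rintro ⟨z, hz, hx, hpos⟩
    obtain ⟨a, b, rfl⟩ := (mem_adjoin_int_iff hroot).1 hx
    obtain rfl : z = a + b * AdjoinSimple.gen ℚ β := Subtype.ext (by simpa using hz)
    rw [key] at hpos
    exact ⟨_, ⟨a, b, rfl, rfl⟩, hpos⟩

end Field

end NegBeta

theorem lemma8 (m : ℕ) (hm : 1 ≤ m) (β : ℝ) (hβ : 1 < β) (hroot : β ^ 2 = m * β + 1) :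
    -- `ℚ(β)` has exactly one automorphism other than the identity, `z ↦ z'`
    (∃! σ : ℚ⟮β⟯ ≃ₐ[ℚ] ℚ⟮β⟯, σ ≠ AlgEquiv.refl) ∧
    ∀ σ : ℚ⟮β⟯ ≃ₐ[ℚ] ℚ⟮β⟯, σ ≠ AlgEquiv.refl →
      NegBeta.finiteExpansions β =
        {x : ℝ | ∃ z : ℚ⟮β⟯, (z : ℝ) = x ∧ x ∈ Algebra.adjoin ℤ {β} ∧ 0 ≤ ((σ z : ℚ⟮β⟯) : ℝ)} := by
  refine ⟨NegBeta.existsUnique_algEquiv_ne_refl hβ hroot, fun σ hσ => Set.ext fun x => ?_⟩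
  rw [Set.mem_ofPred_eq, ← NegBeta.exists_isConj_iff hroot hσ]
  exact ⟨NegBeta.exists_isConj_of_mem_finiteExpansions hβ hroot,
    fun ⟨_, h, hy⟩ => NegBeta.mem_finiteExpansions_of_isConj hβ hroot h hy⟩
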